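/- For all integers $p\ge 1$ and $d\ge 2$, let $L_1,\dots,L_p$ be i.i.d. random vectors uniformly distributed on the unit sphere $S^{d-1}\subset\mathbb R^d$, and let $Z=Z_d$ be a random vector in $\mathbb R^d$ that is independent of $(L_1,\dots,L_p)$; the law of $Z$ depends only on $d$. (1) Suppose that $Z\sim EC_d(0,I)$, that is, $Z$ has a Lebesgue density on $\mathbb R^d$ proportional to $z\mapsto g_d(\|z\|_2^2)$ for some continuous $g_d:[0,\infty)\to[0,\infty)$ for which this function of $z$ is integrable. Suppose further that $(u_d)$ is a sequence of real constants with $\|Z_d\|_2^2/u_d\to 1$ in probability as $d\to\infty$. Then, as $p\to\infty$ and $d\to\infty$, $$\frac{\max_{1\le j\le p}|\langle L_j,Z\rangle|}{\sqrt{u_d\,(1-p^{-2/(d-1)})}}\longrightarrow 1\quad\text{in probability},$$ that is, for every $\delta>0$, $$\lim_{p,d\to\infty}\mathbb P\left(\left|\frac{\max_{1\le j\le p}|\langle L_j,Z\rangle|}{\sqrt{u_d\,(1-p^{-2/(d-1)})}}-1\right|>\delta\right)=0 ,$$ where the limit is a double limit ($p$ and $d$ tend to infinity jointly, without any restriction on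 their relative rates). (2) If $Z\sim N_d(0,I)$, then in the same sense, as $p\to\infty$ and $d\to\infty$, $$\frac{\max_{1\le j\le p}|\langle L_j,Z\rangle|}{\sqrt{d\,(1-p^{-2/(d-1)})}}\longrightarrow 1\quad\text{in probability}.$$ -/

import Mathlib

open MeasureTheory ProbabilityTheory Filter Topology

noncomputable section

/-- The uniform distribution on the unit sphere `S^{d-1}` of `ℝ^d`, as a measure on `ℝ^d`:
the normalized surface measure. (It is a probability measure for `d ≥ 1`.) -/
def unifSphere (d : ℕ) : Measure (EuclideanSpace ℝ (Fin d)) :=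
  (((volume : Measure (EuclideanSpace ℝ (Fin d))).toSphere Set.univ)⁻¹ •
    (volume : Measure (EuclideanSpace ℝ (Fin d))).toSphere).map Subtype.val

/-- The quadratic form `(v - ξ)ᵀ Θ⁻¹ (v - ξ)`. -/
def ellipticalForm {d : ℕ} (ξ : EuclideanSpace ℝ (Fin d)) (Θ : Matrix (Fin d) (Fin d) ℝ)
    (v : EuclideanSpace ℝ (Fin d)) : ℝ :=
  (v - ξ).ofLp ⬝ᵥ (Θ⁻¹.mulVec (v - ξ).ofLp)

/-- `ν` is an elliptical distribution `EC_d(ξ, Θ)`: a probability measure on `ℝ^d` whose Lebesgue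
density is proportional to `v ↦ g ((v - ξ)ᵀ Θ⁻¹ (v - ξ))` for a continuous `g : [0, ∞) → [0, ∞)`
for which this function of `v` is integrable. -/
def IsElliptical {d : ℕ} (ν : Measure (EuclideanSpace ℝ (Fin d)))
    (ξ : EuclideanSpace ℝ (Fin d)) (Θ : Matrix (Fin d) (Fin d) ℝ) : Prop :=
  IsProbabilityMeasure ν ∧ Θ.PosDef ∧
    ∃ (g : ℝ → ℝ) (c : ℝ), 0 < c ∧ ContinuousOn g (Set.Ici 0) ∧ (∀ t, 0 ≤ t → 0 ≤ g t) ∧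
      Integrable (fun v => g (ellipticalForm ξ Θ v)) volume ∧
      ν = volume.withDensity (fun v => ENNReal.ofReal (c * g (ellipticalForm ξ Θ v)))

/-- Convergence in probability to a constant `c`, along the filter `l`, of real random variables
`X i` each living on its own probability space `(Ω i, P i)`. -/
def TendstoInProb {ι : Type*} {Ω : ι → Type*} [∀ i, MeasurableSpace (Ω i)]
    (P : ∀ i, Measure (Ω i)) (X : ∀ i, Ω i → ℝ) (l : Filter ι) (c : ℝ) : Prop :=
  ∀ δ : ℝ, 0 < δ → Tendsto (fun i => P i {ω | δ < |X i ω - c|}) l (𝓝 0)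

/-- `max_{j} |⟨ℓ_j, z⟩|` (for `p ≥ 1` vectors; the value is `0` for `p = 0`). -/
def maxAbsInner {p d : ℕ} (ℓ : Fin p → EuclideanSpace ℝ (Fin d))
    (z : EuclideanSpace ℝ (Fin d)) : ℝ :=
  ⨆ j, |inner ℝ (ℓ j) z|

/-- The normalization `√(u (1 - p^{-2/(d-1)}))`. -/
def rexBound (u : ℝ) (p d : ℕ) : ℝ :=
  √(u * (1 - (p : ℝ) ^ (-(2 : ℝ) / ((d : ℝ) - 1))))

end

/-! Conditionally on `Z`, `|⟨L_j, Z⟩|` is `‖Z‖` times the projection of `L_j` on a fixed unit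
vector, so everything rests on the measure of a double cap `{x | s < |⟨x, v⟩|}`. Writing `n = d -
1`, this measure lies between `C_ε ((1 - s²) / (1 + ε s²))^(n/2)` (`le_unifSphere_cap`) and `2 (1 -
s²)^(n/2)` (`unifSphere_cap_le`), with constants independent of `d`. Both bounds come from replacing
the cap by its cone, weighting with a Gaussian, and integrating one-dimensional tails.

Put `a = p^(-2/n)`, so that `a^(n/2) = 1/p`. At `s² = (1 + η)(1 - a)` the cap has measure at most `2
p^(-(1+η))`, and the union bound gives `2 p^(-η)`. At `s² = (1 - η)(1 - a)` it has measure at least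
`c p^(-(1-η/2))`, and independence gives `exp(-c p^(η/2))`. These errors do not involve `d`, which
is why no relation between the rates of `p` and `d` is needed. What remains is `‖Z‖²/u → 1`, assumed
in the elliptical case and given by Chebyshev in the Gaussian one. -/

/-! ### Uniform measure of cones. -/

/-- Polar coordinates: the integral of a radial function over a cone. -/
lemma setLIntegral_cone_radial {E : Type*} [NormedAddCommGroup E] [NormedSpace ℝ E]
    [MeasurableSpace E] [BorelSpace E] [FiniteDimensional ℝ E] [Nontrivial E]
    (μ : Measure E) [μ.IsAddHaarMeasure] {C : Set E} (hC : MeasurableSet C)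
    (hcone : ∀ r : ℝ, 0 < r → ∀ x, r • x ∈ C ↔ x ∈ C)
    {F : ℝ → ENNReal} (hF : Measurable F) :
    ∫⁻ x in C, F ‖x‖ ∂μ = μ.toSphere (Subtype.val ⁻¹' C) *
      ∫⁻ r : Set.Ioi (0 : ℝ), F r ∂(Measure.volumeIoiPow (Module.finrank ℝ E - 1)) := by
  have hC' : MeasurableSet (Subtype.val ⁻¹' C : Set (Metric.sphere (0 : E) 1)) :=
    measurable_subtype_coe hC
  have hFv : Measurable (fun r : Set.Ioi (0 : ℝ) => F r) := hF.comp measurable_subtype_coe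
  calc ∫⁻ x in C, F ‖x‖ ∂μ = ∫⁻ x in ({0}ᶜ : Set E), C.indicator (fun x => F ‖x‖) x ∂μ := by
        rw [restrict_compl_singleton, lintegral_indicator hC]
    _ = ∫⁻ x : ({0}ᶜ : Set E), C.indicator (fun x => F ‖x‖) x.1 ∂(μ.comap (↑)) := by
        rw [lintegral_subtype_comap (measurableSet_singleton _).compl]
    _ = ∫⁻ z, (Subtype.val ⁻¹' C).indicator 1 z.1 * F z.2
          ∂(μ.toSphere.prod (Measure.volumeIoiPow (Module.finrank ℝ E - 1))) := by
        -- In polar coordinates the indicator of a cone depends on the angle alone and `F` on the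
        -- radius alone.
        rw [← μ.measurePreserving_homeomorphUnitSphereProd.lintegral_comp]
        · refine lintegral_congr fun x => ?_
          have hx : 0 < ‖x.1‖ := norm_pos_iff.2 x.2
          have hmem : ‖x.1‖⁻¹ • x.1 ∈ C ↔ x.1 ∈ C := hcone _ (inv_pos.2 hx) _
          by_cases h : x.1 ∈ C <;> simp [Set.indicator, hmem, h]
        · exact ((measurable_one.indicator hC').comp measurable_fst).mul
            (hFv.comp measurable_snd)
    _ = _ := by
        rw [lintegral_prod_mul (measurable_one.indicator hC').aemeasurable hFv.aemeasurable,
          lintegral_indicator_one hC']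

/-- The uniform measure of the trace of a cone on the sphere, in terms of a radial weight. -/
lemma unifSphere_cone_mul {d : ℕ} (hd : 1 ≤ d) {C : Set (EuclideanSpace ℝ (Fin d))}
    (hC : MeasurableSet C) (hcone : ∀ r : ℝ, 0 < r → ∀ x, r • x ∈ C ↔ x ∈ C)
    {F : ℝ → ENNReal} (hF : Measurable F) :
    unifSphere d C * ∫⁻ x : EuclideanSpace ℝ (Fin d), F ‖x‖ =
      ∫⁻ x in C, F ‖x‖ := by
  have : Nonempty (Fin d) := ⟨⟨0, hd⟩⟩
  have : Nontrivial (EuclideanSpace ℝ (Fin d)) := inferInstance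
  have h0 : (volume : Measure (EuclideanSpace ℝ (Fin d))).toSphere Set.univ ≠ 0 :=
    Measure.measure_univ_ne_zero.2 (Measure.toSphere_ne_zero _)
  have h1 : (volume : Measure (EuclideanSpace ℝ (Fin d))).toSphere Set.univ ≠ ⊤ :=
    measure_ne_top _ _
  -- The whole space is also a cone, with the same radial factor, so that factor never has to be
  -- computed.
  have hu := setLIntegral_cone_radial (volume : Measure (EuclideanSpace ℝ (Fin d)))
    MeasurableSet.univ (by simp) hF
  rw [setLIntegral_univ, Set.preimage_univ] at hu
  rw [setLIntegral_cone_radial volume hC hcone hF, hu, unifSphere,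
    Measure.map_apply measurable_subtype_coe hC, Measure.smul_apply, smul_eq_mul, ← mul_assoc,
    mul_right_comm _ _ (Measure.toSphere _ Set.univ), ENNReal.inv_mul_cancel h0 h1, one_mul]

lemma isProbabilityMeasure_unifSphere {d : ℕ} (hd : 1 ≤ d) :
    IsProbabilityMeasure (unifSphere d) := by
  have : Nonempty (Fin d) := ⟨⟨0, hd⟩⟩
  have : Nontrivial (EuclideanSpace ℝ (Fin d)) := inferInstance
  have h0 : (volume : Measure (EuclideanSpace ℝ (Fin d))).toSphere Set.univ ≠ 0 :=
    Measure.measure_univ_ne_zero.2 (Measure.toSphere_ne_zero _)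
  refine ⟨?_⟩
  rw [unifSphere, Measure.map_apply measurable_subtype_coe .univ, Set.preimage_univ,
    Measure.smul_apply, smul_eq_mul, ENNReal.inv_mul_cancel h0 (measure_ne_top _ _)]

/-- The uniform distribution on the sphere is carried by the sphere. -/
lemma unifSphere_ae_norm_eq_one (d : ℕ) : ∀ᵐ x ∂(unifSphere d), ‖x‖ = 1 := by
  rw [unifSphere, ae_map_iff measurable_subtype_coe.aemeasurable
    (measurableSet_eq_fun measurable_norm measurable_const)]
  exact .of_forall fun x => by simp

/-- Splitting off the coordinate along a unit vector. -/
lemma exists_measurePreserving_split {n : ℕ} {v : EuclideanSpace ℝ (Fin (n + 1))}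
    (hv : ‖v‖ = 1) :
    ∃ e : EuclideanSpace ℝ (Fin (n + 1)) → ℝ × EuclideanSpace ℝ (Fin n),
      MeasurePreserving e volume volume ∧ (∀ x, (e x).1 = inner ℝ x v) ∧
        ∀ x, ‖x‖ ^ 2 = (e x).1 ^ 2 + ‖(e x).2‖ ^ 2 := by
  have horth : Orthonormal ℝ (Set.domRestrict {0} (fun _ : Fin (n + 1) => v)) := by
    refine ⟨fun _ => hv, fun i j hij => (hij (Subsingleton.elim _ _)).elim⟩
  obtain ⟨b, hb⟩ := horth.exists_orthonormalBasis_extension_of_card_eq (by simp)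
  have hb0 : b 0 = v := hb 0 rfl
  refine ⟨fun x => (b.repr x 0, WithLp.toLp 2 fun i => b.repr x i.succ), ?_, fun x => ?_,
    fun x => ?_⟩
  · have h1 := (volume_preserving_piFinSuccAbove (fun _ : Fin (n + 1) => ℝ) 0).comp
      ((PiLp.volume_preserving_ofLp (Fin (n + 1))).comp b.measurePreserving_repr)
    exact ((MeasurePreserving.id (volume : Measure ℝ)).prod
      (PiLp.volume_preserving_toLp (Fin n))).comp h1
  · simp [b.repr_apply_apply, hb0, real_inner_comm]
  · rw [← b.repr.norm_map x, EuclideanSpace.real_norm_sq_eq, EuclideanSpace.real_norm_sq_eq,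
      Fin.sum_univ_succ]

/-! ### Gaussian integrals and tails. -/

lemma lintegral_exp_neg_mul_sq_norm (n : ℕ) {b : ℝ} (hb : 0 < b) :
    ∫⁻ y : EuclideanSpace ℝ (Fin n), ENNReal.ofReal (Real.exp (-b * ‖y‖ ^ 2)) =
      ENNReal.ofReal ((Real.pi / b) ^ ((n : ℝ) / 2)) := by
  have h := GaussianFourier.integral_rexp_neg_mul_sq_norm (V := EuclideanSpace ℝ (Fin n)) hb
  rw [finrank_euclideanSpace_fin] at h
  rw [← h, ofReal_integral_eq_lintegral_ofReal _ (.of_forall fun _ => (Real.exp_pos _).le)]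
  -- A non-integrable function has integral `0` by convention, whereas the known value is positive.
  by_contra hni
  rw [integral_undef hni] at h
  exact absurd h (by positivity)

lemma lintegral_exp_neg_half_sub_sq (a : ℝ) :
    ∫⁻ r : ℝ, ENNReal.ofReal (Real.exp (-(r - a) ^ 2 / 2)) =
      ENNReal.ofReal (√(2 * Real.pi)) := by
  rw [lintegral_sub_right_eq_self (fun r : ℝ => ENNReal.ofReal (Real.exp (-r ^ 2 / 2))) a]
  have h := integral_gaussian (1 / 2)
  have hi := integrable_exp_neg_mul_sq (b := 1 / 2) (by norm_num)
  rw [show √(2 * Real.pi) = √(Real.pi / (1 / 2)) by congr 1; ring, ← h,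
    ofReal_integral_eq_lintegral_ofReal hi (.of_forall fun _ => (Real.exp_pos _).le)]
  refine lintegral_congr fun r => ?_
  congr 2; ring

/-- Gaussian tail, upper bound. -/
lemma setLIntegral_gaussian_tail_le {a : ℝ} (ha : 0 ≤ a) :
    ∫⁻ r in {r : ℝ | a < |r|}, ENNReal.ofReal (Real.exp (-r ^ 2 / 2)) ≤
      ENNReal.ofReal (2 * √(2 * Real.pi) * Real.exp (-a ^ 2 / 2)) := by
  have hm : MeasurableSet {r : ℝ | a < |r|} :=
    measurableSet_lt measurable_const measurable_id.abs
  calc ∫⁻ r in {r : ℝ | a < |r|}, ENNReal.ofReal (Real.exp (-r ^ 2 / 2))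
      ≤ ∫⁻ r : ℝ, ENNReal.ofReal (Real.exp (-a ^ 2 / 2)) *
          (ENNReal.ofReal (Real.exp (-(r - a) ^ 2 / 2)) +
            ENNReal.ofReal (Real.exp (-(r - -a) ^ 2 / 2))) := by
        refine le_trans (setLIntegral_mono' hm fun r hr => ?_) (setLIntegral_le_lintegral _ _)
        rw [mul_add, ← ENNReal.ofReal_mul (Real.exp_pos _).le,
          ← ENNReal.ofReal_mul (Real.exp_pos _).le, ← Real.exp_add, ← Real.exp_add]
        -- For `r > a ≥ 0`, `r² ≥ a² + (r - a)²`; for `-r > a`, the same with `r + a`.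
        rcases lt_abs.1 (show a < |r| from hr) with h | h
        · refine le_add_right (ENNReal.ofReal_le_ofReal (Real.exp_le_exp.2 ?_))
          nlinarith
        · refine le_add_left (ENNReal.ofReal_le_ofReal (Real.exp_le_exp.2 ?_))
          nlinarith
    _ = _ := by
        rw [lintegral_const_mul _ (by fun_prop), lintegral_add_left (by fun_prop),
          lintegral_exp_neg_half_sub_sq, lintegral_exp_neg_half_sub_sq,
          ← ENNReal.ofReal_add (by positivity) (by positivity),
          ← ENNReal.ofReal_mul (Real.exp_pos _).le]
        congr 1; ring

/-- Gaussian tail, lower bound. -/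
lemma le_setLIntegral_gaussian_tail {a ε : ℝ} (ha : 0 ≤ a) (hε : 0 < ε) :
    ENNReal.ofReal (Real.exp (-(1 + 1 / ε) / 2) * Real.exp (-((1 + ε) * a ^ 2) / 2)) ≤
      ∫⁻ r in {r : ℝ | a < |r|}, ENNReal.ofReal (Real.exp (-r ^ 2 / 2)) := by
  have hsub : Set.Ioo a (a + 1) ⊆ {r : ℝ | a < |r|} := fun r hr => lt_of_lt_of_le hr.1 (le_abs_self r)
  refine le_trans ?_ (lintegral_mono_set hsub)
  -- Young's inequality `2a ≤ ε a² + 1/ε`; it costs a factor `1 + ε` in the exponent but keeps the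
  -- prefactor independent of `a`.
  have hsq : (a + 1) ^ 2 ≤ (1 + ε) * a ^ 2 + (1 + 1 / ε) := by
    have : (1 + ε) * a ^ 2 + (1 + 1 / ε) - (a + 1) ^ 2 = (ε * a - 1) ^ 2 / ε := by
      field_simp; ring
    have h2 : 0 ≤ (ε * a - 1) ^ 2 / ε := by positivity
    linarith
  calc _ = ∫⁻ r in Set.Ioo a (a + 1), ENNReal.ofReal
          (Real.exp (-(1 + 1 / ε) / 2) * Real.exp (-((1 + ε) * a ^ 2) / 2)) := by
        rw [setLIntegral_const, Real.volume_Ioo]; simp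
    _ ≤ _ := by
        refine setLIntegral_mono' measurableSet_Ioo fun r hr => ENNReal.ofReal_le_ofReal ?_
        rw [← Real.exp_add]
        refine Real.exp_le_exp.2 ?_
        have : r ^ 2 ≤ (a + 1) ^ 2 := pow_le_pow_left₀ (ha.trans hr.1.le) hr.2.le 2
        linarith

/-! ### Measure of double spherical caps. -/

/-- The measure of a double spherical cap as a Gaussian integral of one-dimensional tails. -/
lemma unifSphere_cap_mul {n : ℕ} {s : ℝ} (hs0 : 0 ≤ s) (hs1 : s < 1)
    {v : EuclideanSpace ℝ (Fin (n + 1))} (hv : ‖v‖ = 1) :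
    unifSphere (n + 1) {x | s < |inner ℝ x v|} *
        ENNReal.ofReal ((2 * Real.pi) ^ (((n : ℝ) + 1) / 2)) =
      ∫⁻ y : EuclideanSpace ℝ (Fin n), ENNReal.ofReal (Real.exp (-‖y‖ ^ 2 / 2)) *
        ∫⁻ r in {r : ℝ | s / √(1 - s ^ 2) * ‖y‖ < |r|},
          ENNReal.ofReal (Real.exp (-r ^ 2 / 2)) := by
  have hq : 0 < 1 - s ^ 2 := by nlinarith
  have hq' : 0 < √(1 - s ^ 2) := Real.sqrt_pos.2 hq
  set C : Set (EuclideanSpace ℝ (Fin (n + 1))) := {x | s * ‖x‖ < |inner ℝ x v|} with hCdef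
  have hC : MeasurableSet C := measurableSet_lt (by fun_prop) (by fun_prop)
  have hcap : unifSphere (n + 1) {x | s < |inner ℝ x v|} = unifSphere (n + 1) C := by
    refine measure_congr ?_
    filter_upwards [unifSphere_ae_norm_eq_one (n + 1)] with x hx
    simp only [hCdef, eq_iff_iff]
    change s < _ ↔ s * ‖x‖ < _
    rw [hx, mul_one]
  have hcone : ∀ r : ℝ, 0 < r → ∀ x, r • x ∈ C ↔ x ∈ C := fun r hr x => by
    simp only [hCdef, Set.mem_ofPred_eq, norm_smul, real_inner_smul_left, abs_mul,
      Real.norm_eq_abs, abs_of_pos hr]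
    rw [mul_left_comm]
    exact mul_lt_mul_iff_right₀ hr
  have hF : Measurable fun r : ℝ => ENNReal.ofReal (Real.exp (-r ^ 2 / 2)) := by fun_prop
  have key := unifSphere_cone_mul (Nat.le_add_left 1 n) hC hcone hF
  have htot : ∫⁻ x : EuclideanSpace ℝ (Fin (n + 1)), ENNReal.ofReal (Real.exp (-‖x‖ ^ 2 / 2)) =
      ENNReal.ofReal ((2 * Real.pi) ^ (((n : ℝ) + 1) / 2)) := by
    have h := lintegral_exp_neg_mul_sq_norm (n + 1) (b := 1 / 2) (by norm_num)
    rw [show Real.pi / (1 / 2) = 2 * Real.pi by ring] at h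
    push_cast at h
    rw [← h]
    refine lintegral_congr fun x => ?_
    congr 2; ring
  obtain ⟨e, he, he1, he2⟩ := exists_measurePreserving_split hv
  set S : Set (ℝ × EuclideanSpace ℝ (Fin n)) := {z | s / √(1 - s ^ 2) * ‖z.2‖ < |z.1|} with hS
  have hSm : MeasurableSet S := measurableSet_lt (by fun_prop) (by fun_prop)
  -- With `x = (r, y)`, squaring turns `s ‖x‖ < |r|` into `s² ‖y‖² < (1 - s²) r²`.
  have hmem : ∀ x, x ∈ C ↔ e x ∈ S := fun x => by
    simp only [hCdef, hS, Set.mem_ofPred_eq, ← he1]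
    rw [← abs_of_nonneg (mul_nonneg hs0 (norm_nonneg x)),
      ← abs_of_nonneg (mul_nonneg (div_nonneg hs0 hq'.le) (norm_nonneg (e x).2)),
      ← sq_lt_sq, ← sq_lt_sq, mul_pow, mul_pow, div_pow, Real.sq_sqrt hq.le, he2, div_mul_eq_mul_div,
      div_lt_iff₀ hq]
    constructor <;> intro h <;> linarith
  have hind : Measurable (S.indicator fun z : ℝ × EuclideanSpace ℝ (Fin n) =>
      ENNReal.ofReal (Real.exp (-‖z.2‖ ^ 2 / 2)) * ENNReal.ofReal (Real.exp (-z.1 ^ 2 / 2))) :=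
    Measurable.indicator (by fun_prop) hSm
  rw [hcap, ← htot, key, ← lintegral_indicator hC]
  calc _ = ∫⁻ x, (S.indicator fun z => ENNReal.ofReal (Real.exp (-‖z.2‖ ^ 2 / 2)) *
          ENNReal.ofReal (Real.exp (-z.1 ^ 2 / 2))) (e x) := by
        refine lintegral_congr fun x => ?_
        by_cases hx : x ∈ C
        · rw [Set.indicator_of_mem hx, Set.indicator_of_mem ((hmem x).1 hx),
            ← ENNReal.ofReal_mul (Real.exp_pos _).le, ← Real.exp_add, he2]
          congr 2; ring
        · rw [Set.indicator_of_notMem hx, Set.indicator_of_notMem (fun h => hx ((hmem x).2 h))]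
    _ = _ := by
        rw [he.lintegral_comp hind, Measure.volume_eq_prod, lintegral_prod_symm _ hind.aemeasurable]
        refine lintegral_congr fun y => ?_
        have hm : MeasurableSet {r : ℝ | s / √(1 - s ^ 2) * ‖y‖ < |r|} :=
          measurableSet_lt measurable_const measurable_id.abs
        rw [← lintegral_const_mul _ (by fun_prop), ← lintegral_indicator hm]
        rfl

/-- Upper bound for the measure of a double spherical cap. -/
lemma unifSphere_cap_le {n : ℕ} {s : ℝ} (hs0 : 0 ≤ s) (hs1 : s < 1)
    {v : EuclideanSpace ℝ (Fin (n + 1))} (hv : ‖v‖ = 1) :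
    unifSphere (n + 1) {x | s < |inner ℝ x v|} ≤
      ENNReal.ofReal (2 * (1 - s ^ 2) ^ ((n : ℝ) / 2)) := by
  have hq : 0 < 1 - s ^ 2 := by nlinarith
  have hpi := Real.pi_pos
  have hK : 0 < (2 * Real.pi) ^ (((n : ℝ) + 1) / 2) := by positivity
  rw [← ENNReal.mul_le_mul_iff_left (ENNReal.ofReal_pos.2 hK).ne' ENNReal.ofReal_ne_top,
    unifSphere_cap_mul hs0 hs1 hv]
  calc _ ≤ ∫⁻ y : EuclideanSpace ℝ (Fin n), ENNReal.ofReal (2 * √(2 * Real.pi)) *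
          ENNReal.ofReal (Real.exp (-(1 / (2 * (1 - s ^ 2))) * ‖y‖ ^ 2)) := by
        refine lintegral_mono fun y => ?_
        refine (mul_le_mul_right (setLIntegral_gaussian_tail_le (by positivity)) _).trans_eq ?_
        rw [← ENNReal.ofReal_mul (by positivity), ← ENNReal.ofReal_mul (by positivity),
          mul_left_comm, ← Real.exp_add, mul_pow, div_pow, Real.sq_sqrt hq.le]
        congr 3
        field_simp; ring
    _ = _ := by
        rw [lintegral_const_mul _ (by fun_prop), lintegral_exp_neg_mul_sq_norm _ (by positivity),
          ← ENNReal.ofReal_mul (by positivity), ← ENNReal.ofReal_mul (by positivity)]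
        congr 1
        rw [show Real.pi / (1 / (2 * (1 - s ^ 2))) = (1 - s ^ 2) * (2 * Real.pi) by
          field_simp, Real.mul_rpow hq.le (by positivity), add_div,
          Real.rpow_add (by positivity), Real.sqrt_eq_rpow]
        ring

/-- Lower bound for the measure of a double spherical cap. -/
lemma le_unifSphere_cap {n : ℕ} {s ε : ℝ} (hε : 0 < ε) (hs0 : 0 ≤ s) (hs1 : s < 1)
    {v : EuclideanSpace ℝ (Fin (n + 1))} (hv : ‖v‖ = 1) :
    ENNReal.ofReal (Real.exp (-(1 + 1 / ε) / 2) / √(2 * Real.pi) *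
        ((1 - s ^ 2) / (1 + ε * s ^ 2)) ^ ((n : ℝ) / 2)) ≤
      unifSphere (n + 1) {x | s < |inner ℝ x v|} := by
  have hq : 0 < 1 - s ^ 2 := by nlinarith
  have hpi := Real.pi_pos
  have hK : 0 < (2 * Real.pi) ^ (((n : ℝ) + 1) / 2) := by positivity
  rw [← ENNReal.mul_le_mul_iff_left (ENNReal.ofReal_pos.2 hK).ne' ENNReal.ofReal_ne_top,
    unifSphere_cap_mul hs0 hs1 hv]
  calc _ = ∫⁻ y : EuclideanSpace ℝ (Fin n), ENNReal.ofReal (Real.exp (-(1 + 1 / ε) / 2)) *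
          ENNReal.ofReal (Real.exp (-((1 + ε * s ^ 2) / (2 * (1 - s ^ 2))) * ‖y‖ ^ 2)) := by
        rw [lintegral_const_mul _ (by fun_prop), lintegral_exp_neg_mul_sq_norm _ (by positivity),
          ← ENNReal.ofReal_mul (by positivity), ← ENNReal.ofReal_mul (by positivity)]
        congr 1
        rw [show Real.pi / ((1 + ε * s ^ 2) / (2 * (1 - s ^ 2))) =
          ((1 - s ^ 2) / (1 + ε * s ^ 2)) * (2 * Real.pi) by field_simp,
          Real.mul_rpow (x := (1 - s ^ 2) / (1 + ε * s ^ 2)) (by positivity) (by positivity),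
          add_div (n : ℝ), Real.rpow_add (by positivity), Real.sqrt_eq_rpow]
        have h2 : (2 * Real.pi) ^ ((1 : ℝ) / 2) ≠ 0 := by positivity
        generalize (2 * Real.pi) ^ ((1 : ℝ) / 2) = B at h2
        generalize ((1 - s ^ 2) / (1 + ε * s ^ 2)) ^ ((n : ℝ) / 2) = A
        field_simp
    _ ≤ _ := by
        refine lintegral_mono fun y => ?_
        refine le_trans (le_of_eq ?_)
          (mul_le_mul_right (le_setLIntegral_gaussian_tail (by positivity) hε) _)
        rw [← ENNReal.ofReal_mul (by positivity), ← ENNReal.ofReal_mul (by positivity),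
          mul_left_comm, ← Real.exp_add (-‖y‖ ^ 2 / 2), mul_pow, div_pow, Real.sq_sqrt hq.le]
        congr 3
        field_simp; ring

/-! ### Tail bounds for the maximum. -/

lemma measurable_maxAbsInner {p d : ℕ} :
    Measurable fun q : (Fin p → EuclideanSpace ℝ (Fin d)) × EuclideanSpace ℝ (Fin d) =>
      maxAbsInner q.1 q.2 := by
  unfold maxAbsInner
  exact Measurable.iSup fun j => by fun_prop

lemma abs_inner_le_maxAbsInner {p d : ℕ} (l : Fin p → EuclideanSpace ℝ (Fin d))
    (z : EuclideanSpace ℝ (Fin d)) (j : Fin p) : |inner ℝ (l j) z| ≤ maxAbsInner l z :=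
  le_ciSup (f := fun j => |inner ℝ (l j) z|) (Set.finite_range _).bddAbove j

/-- An event about independent variables whose sections all have probability at most `c`. -/
lemma measure_le_of_indepFun {Ω α β : Type*} [MeasurableSpace Ω] [MeasurableSpace α]
    [MeasurableSpace β] {P : Measure Ω} [IsProbabilityMeasure P] {X : Ω → α} {Y : Ω → β}
    {μ : Measure α} (hX : HasLaw X μ P) (hY : AEMeasurable Y P) (hXY : IndepFun X Y P)
    {B : Set (α × β)} (hB : MeasurableSet B) {c : ENNReal}
    (h : ∀ y, μ {x | (x, y) ∈ B} ≤ c) : P {ω | (X ω, Y ω) ∈ B} ≤ c := by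
  have : IsProbabilityMeasure μ := hX.map_eq ▸ Measure.isProbabilityMeasure_map hX.aemeasurable
  have : IsProbabilityMeasure (P.map Y) := Measure.isProbabilityMeasure_map hY
  have hmap := (indepFun_iff_map_prod_eq_prod_map_map hX.aemeasurable hY).1 hXY
  rw [hX.map_eq] at hmap
  calc P {ω | (X ω, Y ω) ∈ B} = (μ.prod (P.map Y)) B := by
        rw [← hmap, Measure.map_apply_of_aemeasurable (hX.aemeasurable.prodMk hY) hB]
        rfl
    _ = ∫⁻ y, μ {x | (x, y) ∈ B} ∂(P.map Y) := Measure.prod_apply_symm hB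
    _ ≤ ∫⁻ _, c ∂(P.map Y) := lintegral_mono h
    _ = c := by simp

lemma hasLaw_pi_of_iIndepFun {Ω α : Type*} [MeasurableSpace Ω] [MeasurableSpace α] {p : ℕ}
    {P : Measure Ω} [IsProbabilityMeasure P] {L : Fin p → Ω → α} {μ : Measure α}
    (hL : ∀ j, HasLaw (L j) μ P) (hind : iIndepFun L P) :
    HasLaw (fun ω j => L j ω) (Measure.pi fun _ => μ) P where
  aemeasurable := aemeasurable_pi_lambda _ fun j => (hL j).aemeasurable
  map_eq := by
    rw [(iIndepFun_iff_map_fun_eq_pi_map fun j => (hL j).aemeasurable).1 hind]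
    simp_rw [(hL _).map_eq]

lemma abs_inner_normalize {d : ℕ} (x : EuclideanSpace ℝ (Fin d)) {z : EuclideanSpace ℝ (Fin d)}
    (hz : z ≠ 0) : |inner ℝ x z| = |inner ℝ x (‖z‖⁻¹ • z)| * ‖z‖ := by
  have hz' : ‖z‖ ≠ 0 := norm_ne_zero_iff.2 hz
  rw [real_inner_smul_right, abs_mul, abs_inv, abs_norm]
  field_simp

section Max

variable {Ω : Type*} [MeasurableSpace Ω] {P : Measure Ω} [IsProbabilityMeasure P] {p d : ℕ}
  {L : Fin p → Ω → EuclideanSpace ℝ (Fin d)} {Z : Ω → EuclideanSpace ℝ (Fin d)}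

/-- Union bound for the maximum of the projections. -/
lemma measure_lt_maxAbsInner_le (hp : 1 ≤ p) (hd : 1 ≤ d)
    (hL : ∀ j, HasLaw (L j) (unifSphere d) P) (hind : iIndepFun L P) (hZ : AEMeasurable Z P)
    (hLZ : IndepFun (fun ω j => L j ω) Z P) {s : ℝ} {c : ENNReal}
    (hcap : ∀ v : EuclideanSpace ℝ (Fin d), ‖v‖ = 1 →
      unifSphere d {x | s < |inner ℝ x v|} ≤ c) :
    P {ω | s * ‖Z ω‖ < maxAbsInner (fun j => L j ω) (Z ω)} ≤ p * c := by
  have := isProbabilityMeasure_unifSphere hd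
  have : Nonempty (Fin p) := ⟨⟨0, hp⟩⟩
  refine measure_le_of_indepFun (hasLaw_pi_of_iIndepFun hL hind) hZ hLZ
    (B := {q | s * ‖q.2‖ < maxAbsInner q.1 q.2})
    (measurableSet_lt (by fun_prop) measurable_maxAbsInner) fun z => ?_
  -- At `z = 0` both sides vanish, so the strict inequality fails.
  rcases eq_or_ne z 0 with rfl | hz
  · simp [maxAbsInner]
  have hz' : 0 < ‖z‖ := norm_pos_iff.2 hz
  have hv : ‖‖z‖⁻¹ • z‖ = 1 := by rw [norm_smul, norm_inv, norm_norm, inv_mul_cancel₀ hz'.ne']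
  set A : Set (EuclideanSpace ℝ (Fin d)) := {x | s < |inner ℝ x (‖z‖⁻¹ • z)|} with hA
  have hAm : MeasurableSet A := measurableSet_lt (by fun_prop) (by fun_prop)
  calc _ ≤ (Measure.pi fun _ : Fin p => unifSphere d) (⋃ j, Function.eval j ⁻¹' A) := by
        refine measure_mono fun l hl => ?_
        obtain ⟨j, hj⟩ := exists_lt_of_lt_ciSup (f := fun j => |inner ℝ (l j) z|) hl
        refine Set.mem_iUnion.2 ⟨j, ?_⟩
        change s < |inner ℝ (l j) (‖z‖⁻¹ • z)|
        dsimp only at hj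
        rw [abs_inner_normalize _ hz] at hj
        exact lt_of_mul_lt_mul_right hj hz'.le
    _ ≤ ∑ j : Fin p, (Measure.pi fun _ : Fin p => unifSphere d) (Function.eval j ⁻¹' A) :=
        measure_iUnion_fintype_le _ _
    _ ≤ ∑ _j : Fin p, c := by
        refine Finset.sum_le_sum fun j _ => ?_
        rw [(measurePreserving_eval (fun _ : Fin p => unifSphere d) j).measure_preimage
          hAm.nullMeasurableSet]
        exact hcap _ hv
    _ = p * c := by simp

/-- Independence bound for the maximum of the projections. -/
lemma measure_maxAbsInner_lt_le (hp : 1 ≤ p) (hd : 1 ≤ d)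
    (hL : ∀ j, HasLaw (L j) (unifSphere d) P) (hind : iIndepFun L P) (hZ : AEMeasurable Z P)
    (hLZ : IndepFun (fun ω j => L j ω) Z P) {s q : ℝ} (hq : 0 ≤ q)
    (hcap : ∀ v : EuclideanSpace ℝ (Fin d), ‖v‖ = 1 →
      ENNReal.ofReal q ≤ unifSphere d {x | s < |inner ℝ x v|}) :
    P {ω | maxAbsInner (fun j => L j ω) (Z ω) < s * ‖Z ω‖} ≤
      ENNReal.ofReal (Real.exp (-(p * q))) := by
  have := isProbabilityMeasure_unifSphere hd
  have : Nonempty (Fin p) := ⟨⟨0, hp⟩⟩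
  refine measure_le_of_indepFun (hasLaw_pi_of_iIndepFun hL hind) hZ hLZ
    (B := {q | maxAbsInner q.1 q.2 < s * ‖q.2‖})
    (measurableSet_lt measurable_maxAbsInner (by fun_prop)) fun z => ?_
  rcases eq_or_ne z 0 with rfl | hz
  · simp [maxAbsInner]
  have hz' : 0 < ‖z‖ := norm_pos_iff.2 hz
  have hv : ‖‖z‖⁻¹ • z‖ = 1 := by rw [norm_smul, norm_inv, norm_norm, inv_mul_cancel₀ hz'.ne']
  set A : Set (EuclideanSpace ℝ (Fin d)) := {x | s < |inner ℝ x (‖z‖⁻¹ • z)|} with hA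
  have hAm : MeasurableSet A := measurableSet_lt (by fun_prop) (by fun_prop)
  have hAc : unifSphere d Aᶜ ≤ ENNReal.ofReal (Real.exp (-q)) := by
    rw [prob_compl_eq_one_sub hAm]
    refine (tsub_le_tsub_left (hcap _ hv) 1).trans ?_
    rw [← ENNReal.ofReal_one, ← ENNReal.ofReal_sub _ hq]
    exact ENNReal.ofReal_le_ofReal (Real.one_sub_le_exp_neg q)
  calc _ ≤ (Measure.pi fun _ : Fin p => unifSphere d) (Set.univ.pi fun _ => Aᶜ) := by
        refine measure_mono fun l hl j _ hj => ?_
        have h1 : maxAbsInner l z < s * ‖z‖ := hl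
        have h2 := (abs_inner_le_maxAbsInner l z j).trans_lt h1
        rw [abs_inner_normalize _ hz] at h2
        exact lt_asymm (lt_of_mul_lt_mul_right h2 hz'.le) hj
    _ = (unifSphere d Aᶜ) ^ p := by rw [Measure.pi_pi]; simp
    _ ≤ (ENNReal.ofReal (Real.exp (-q))) ^ p := pow_le_pow_left' hAc p
    _ = _ := by
        rw [← ENNReal.ofReal_pow (Real.exp_pos _).le, ← Real.exp_nat_mul]
        congr 2; ring

end Max

/-! ### Cap bounds at the thresholds `(1 ± η)(1 - a)`. -/

section Numeric

variable {p n : ℕ}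

lemma rpow_neg_two_div_rpow (hp : 1 ≤ p) (hn : 1 ≤ n) (t : ℝ) :
    (((p : ℝ) ^ (-(2 : ℝ) / n)) ^ t) ^ ((n : ℝ) / 2) = (p : ℝ) ^ (-t) := by
  have hn' : (n : ℝ) ≠ 0 := by positivity
  rw [← Real.rpow_mul (by positivity), ← Real.rpow_mul (by positivity)]
  congr 1
  field_simp

/-- Bernoulli's inequality; the left side is `1 - s²` at the upper threshold. -/
lemma sub_mul_one_sub_le_rpow {a : ℝ} (ha : 0 < a) {η : ℝ} (hη : 0 ≤ η) :
    1 - (1 + η) * (1 - a) ≤ a ^ (1 + η) := by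
  have h1 : Real.log (1 / a) ≤ 1 / a - 1 := Real.log_le_sub_one_of_pos (by positivity)
  have h2 : 1 + η * -(1 / a - 1) ≤ a ^ η := by
    rw [Real.rpow_def_of_pos ha]
    refine le_trans ?_ (Real.add_one_le_exp _)
    rw [one_div, Real.log_inv] at h1
    rw [one_div]
    nlinarith
  rw [Real.rpow_add ha, Real.rpow_one]
  refine le_trans (le_of_eq ?_) (mul_le_mul_of_nonneg_left h2 ha.le)
  field_simp
  ring

/-- Weighted AM-GM of `a` and `1` bounds the numerator below by `a^(1-η)`, and `-log a ≥ 1 - a`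
bounds the denominator above by `a^(-ε)`. -/
lemma rpow_le_one_sub_mul_div {a : ℝ} (ha : 0 < a) (ha1 : a ≤ 1) {η ε : ℝ} (hη : 0 ≤ η)
    (hη1 : η ≤ 1) (hε : 0 ≤ ε) :
    a ^ (1 - η + ε) ≤ (1 - (1 - η) * (1 - a)) / (1 + ε * ((1 - η) * (1 - a))) := by
  have hs : 0 ≤ (1 - η) * (1 - a) := mul_nonneg (by linarith) (by linarith)
  have h1 : a ^ (1 - η) ≤ 1 - (1 - η) * (1 - a) := by
    have h := Real.geom_mean_le_arith_mean2_weighted (w₁ := 1 - η) (w₂ := η) (p₁ := a) (p₂ := 1)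
      (by linarith) hη ha.le zero_le_one (by ring)
    rw [Real.one_rpow, mul_one] at h
    linarith
  have h2 : 1 + ε * ((1 - η) * (1 - a)) ≤ a ^ (-ε) := by
    have hlog := Real.log_le_sub_one_of_pos ha
    rw [Real.rpow_def_of_pos ha, add_comm]
    refine (Real.add_one_le_exp _).trans (Real.exp_le_exp.2 ?_)
    have : (1 - η) * (1 - a) ≤ -Real.log a := by nlinarith
    nlinarith
  rw [le_div_iff₀ (by positivity), Real.rpow_add ha]
  calc a ^ (1 - η) * a ^ ε * (1 + ε * ((1 - η) * (1 - a)))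
      ≤ a ^ (1 - η) * a ^ ε * a ^ (-ε) := by gcongr
    _ = a ^ (1 - η) := by rw [mul_assoc, ← Real.rpow_add ha]; simp
    _ ≤ _ := h1

lemma rpow_neg_two_div_lt_one (hp : 2 ≤ p) (hn : 1 ≤ n) : (p : ℝ) ^ (-(2 : ℝ) / n) < 1 := by
  have hp' : (2 : ℝ) ≤ p := by exact_mod_cast hp
  have hn' : (0 : ℝ) < n := by exact_mod_cast hn
  exact Real.rpow_lt_one_of_one_lt_of_neg (by linarith)
    (div_neg_of_neg_of_pos (by norm_num) hn')

lemma unifSphere_cap_le_rpow (hp : 2 ≤ p) (hn : 1 ≤ n) {η : ℝ} (hη : 0 ≤ η)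
    {v : EuclideanSpace ℝ (Fin (n + 1))} (hv : ‖v‖ = 1) :
    unifSphere (n + 1) {x | √((1 + η) * (1 - (p : ℝ) ^ (-(2 : ℝ) / n))) < |inner ℝ x v|} ≤
      ENNReal.ofReal (2 * (p : ℝ) ^ (-(1 + η))) := by
  have ha1 := rpow_neg_two_div_lt_one hp hn
  have ha : 0 < (p : ℝ) ^ (-(2 : ℝ) / n) := by positivity
  have hrp := rpow_neg_two_div_rpow (p := p) (by lia) hn (1 + η)
  set a := (p : ℝ) ^ (-(2 : ℝ) / n)
  have hnn : 0 ≤ (1 + η) * (1 - a) := mul_nonneg (by linarith) (by linarith)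
  set s := √((1 + η) * (1 - a))
  rcases lt_or_ge s 1 with hs | hs
  · have hs2 : s ^ 2 = (1 + η) * (1 - a) := Real.sq_sqrt hnn
    have hs0 : 0 ≤ s := Real.sqrt_nonneg _
    refine (unifSphere_cap_le hs0 hs hv).trans (ENNReal.ofReal_le_ofReal ?_)
    rw [← hrp]
    have h0 : 0 ≤ 1 - s ^ 2 := by nlinarith
    gcongr
    rw [hs2]
    exact sub_mul_one_sub_le_rpow ha hη
  -- The upper threshold can reach `1`; by Cauchy–Schwarz the cap is then null.
  · refine le_of_eq_of_le ?_ zero_le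
    refine measure_mono_null (t := {x | ¬ ‖x‖ = 1}) (fun x hx hx1 => ?_)
      (unifSphere_ae_norm_eq_one (n + 1))
    have := abs_real_inner_le_norm x v
    rw [hx1, hv, one_mul] at this
    exact absurd (lt_of_le_of_lt hs hx) this.not_gt

/-- The loss is taken as `ε = η/2`, so the exponent `1 - η + ε = 1 - η/2` stays below `1` and `p`
times the cap measure still diverges. -/
lemma rpow_le_unifSphere_cap (hp : 2 ≤ p) (hn : 1 ≤ n) {η : ℝ} (hη : 0 < η) (hη1 : η < 1)
    {v : EuclideanSpace ℝ (Fin (n + 1))} (hv : ‖v‖ = 1) :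
    ENNReal.ofReal (Real.exp (-(1 + 1 / (η / 2)) / 2) / √(2 * Real.pi) *
        (p : ℝ) ^ (-(1 - η / 2))) ≤
      unifSphere (n + 1) {x | √((1 - η) * (1 - (p : ℝ) ^ (-(2 : ℝ) / n))) < |inner ℝ x v|} := by
  have ha1 := rpow_neg_two_div_lt_one hp hn
  have ha : 0 < (p : ℝ) ^ (-(2 : ℝ) / n) := by positivity
  have hrp := rpow_neg_two_div_rpow (p := p) (by lia) hn (1 - η / 2)
  set a := (p : ℝ) ^ (-(2 : ℝ) / n)
  have hnn : 0 ≤ (1 - η) * (1 - a) := mul_nonneg (by linarith) (by linarith)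
  have hs2 : √((1 - η) * (1 - a)) ^ 2 = (1 - η) * (1 - a) := Real.sq_sqrt hnn
  have hs : √((1 - η) * (1 - a)) < 1 := by
    rw [Real.sqrt_lt' one_pos]; nlinarith
  refine le_trans (ENNReal.ofReal_le_ofReal ?_)
    (le_unifSphere_cap (half_pos hη) (Real.sqrt_nonneg _) hs hv)
  rw [← hrp, hs2]
  gcongr
  convert rpow_le_one_sub_mul_div ha ha1.le hη.le hη1.le (half_pos hη).le using 2
  ring

/-- The same `η` governs the norm and the projection, so `√((1 ± η) b) · √((1 ± η) u)` is exactly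
`(1 ± η) √(u b)`. -/
lemma abs_div_sqrt_sub_one_le {M N u b η : ℝ} (hN : 0 ≤ N) (hu : 0 < u) (hb : 0 < b)
    (hη : 0 ≤ η) (hη1 : η ≤ 1) (hNu : |N ^ 2 / u - 1| ≤ η) (hup : M ≤ √((1 + η) * b) * N)
    (hlo : √((1 - η) * b) * N ≤ M) : |M / √(u * b) - 1| ≤ η := by
  obtain ⟨h1, h2⟩ := abs_le.1 hNu
  have hR : 0 < √(u * b) := Real.sqrt_pos.2 (by positivity)
  have hN2 : N ≤ √((1 + η) * u) := Real.le_sqrt_of_sq_le ((div_le_iff₀ hu).1 (by linarith))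
  have hN1 : √((1 - η) * u) ≤ N :=
    Real.sqrt_le_iff.2 ⟨hN, (le_div_iff₀ hu).1 (by linarith)⟩
  have hmul : ∀ t : ℝ, 0 ≤ t → √(t * b) * √(t * u) = t * √(u * b) := fun t ht => by
    rw [Real.sqrt_mul ht, Real.sqrt_mul ht, Real.sqrt_mul hu.le,
      mul_mul_mul_comm, Real.mul_self_sqrt ht]
    ring
  rw [abs_le]
  constructor
  · rw [neg_le_sub_iff_le_add, ← sub_le_iff_le_add, le_div_iff₀ hR,
      ← hmul _ (sub_nonneg.2 hη1)]
    exact (mul_le_mul_of_nonneg_left hN1 (Real.sqrt_nonneg _)).trans hlo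
  · rw [sub_le_iff_le_add, div_le_iff₀ hR, add_comm η, ← hmul _ (by linarith)]
    exact hup.trans (mul_le_mul_of_nonneg_left hN2 (Real.sqrt_nonneg _))

end Numeric

/-! ### Convergence in probability. -/

/-- Non-asymptotic bound for the deviation of the normalized maximum. -/
lemma measure_maxAbsInner_div_rexBound_le {Ω : Type*} [MeasurableSpace Ω] {P : Measure Ω}
    [IsProbabilityMeasure P] {p d : ℕ} (hp : 2 ≤ p) (hd : 2 ≤ d)
    {L : Fin p → Ω → EuclideanSpace ℝ (Fin d)} {Z : Ω → EuclideanSpace ℝ (Fin d)}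
    (hL : ∀ j, HasLaw (L j) (unifSphere d) P) (hind : iIndepFun L P) (hZ : AEMeasurable Z P)
    (hLZ : IndepFun (fun ω j => L j ω) Z P) {u η : ℝ} (hu : 0 < u) (hη : 0 < η) (hη1 : η < 1) :
    P {ω | η < |maxAbsInner (fun j => L j ω) (Z ω) / rexBound u p d - 1|} ≤
      P {ω | η < |‖Z ω‖ ^ 2 / u - 1|} + ENNReal.ofReal (2 * (p : ℝ) ^ (-η)) +
        ENNReal.ofReal (Real.exp (-(Real.exp (-(1 + 1 / (η / 2)) / 2) / √(2 * Real.pi) *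
          (p : ℝ) ^ (η / 2)))) := by
  obtain ⟨n, rfl⟩ : ∃ n, d = n + 1 := ⟨d - 1, by lia⟩
  have hn : 1 ≤ n := by lia
  have hp0 : (0 : ℝ) < p := by positivity
  have hb : 0 < 1 - (p : ℝ) ^ (-(2 : ℝ) / n) := sub_pos.2 (rpow_neg_two_div_lt_one hp hn)
  have hup := measure_lt_maxAbsInner_le (by lia) (by lia) hL hind hZ hLZ
    fun v hv => unifSphere_cap_le_rpow hp hn hη.le hv
  have hlo := measure_maxAbsInner_lt_le (by lia) (by lia) hL hind hZ hLZ (by positivity)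
    fun v hv => rpow_le_unifSphere_cap hp hn hη hη1 hv
  rw [← ENNReal.ofReal_natCast, ← ENNReal.ofReal_mul hp0.le,
    show (p : ℝ) * (2 * (p : ℝ) ^ (-(1 + η))) = 2 * (p : ℝ) ^ (-η) by
      rw [neg_add, Real.rpow_add hp0, Real.rpow_neg_one]; field_simp] at hup
  rw [mul_left_comm, show (p : ℝ) * (p : ℝ) ^ (-(1 - η / 2)) = (p : ℝ) ^ (η / 2) by
      rw [neg_sub, Real.rpow_sub hp0, Real.rpow_one]; field_simp] at hlo
  refine le_trans (measure_mono fun ω hω => ?_)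
    ((measure_union_le _ _).trans (add_le_add ((measure_union_le _ _).trans
      (add_le_add le_rfl hup)) hlo))
  by_contra hcon
  simp only [Set.mem_union, Set.mem_ofPred_eq, not_or, not_lt] at hcon hω
  refine hω.not_ge ?_
  have hR : rexBound u p (n + 1) = √(u * (1 - (p : ℝ) ^ (-(2 : ℝ) / n))) := by
    simp [rexBound]
  rw [hR]
  exact abs_div_sqrt_sub_one_le (norm_nonneg _) hu hb hη.le hη1.le hcon.1.1 hcon.1.2 hcon.2

/-- If `u d ≤ 0` the ratio is nonpositive (`0` when `u d = 0`, by the convention for division), so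
it misses `1` by more than `1/2` with probability one. -/
lemma TendstoInProb.eventually_pos {ν : ∀ d : ℕ, Measure (EuclideanSpace ℝ (Fin d))} {u : ℕ → ℝ}
    (hν : ∀ d, 2 ≤ d → IsProbabilityMeasure (ν d))
    (h : TendstoInProb ν (fun d z => ‖z‖ ^ 2 / u d) atTop 1) : ∀ᶠ d in atTop, 0 < u d := by
  filter_upwards [(h (1 / 2) (by norm_num)).eventually_lt_const one_pos, eventually_ge_atTop 2]
    with d hd hd2
  have := hν d hd2
  by_contra! hu
  refine hd.ne ?_
  convert measure_univ (μ := ν d)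
  refine Set.eq_univ_of_forall fun z => ?_
  have : ‖z‖ ^ 2 / u d ≤ 0 := div_nonpos_of_nonneg_of_nonpos (by positivity) hu
  change 1 / 2 < |‖z‖ ^ 2 / u d - 1|
  rw [abs_of_neg (by linarith)]
  linarith

/-- The normalized maximum converges as soon as `‖Z‖ ^ 2 / u` does. -/
theorem tendstoInProb_maxAbsInner_div_rexBound
    {Ω : ℕ → ℕ → Type*} [∀ p d, MeasurableSpace (Ω p d)]
    {P : ∀ p d, Measure (Ω p d)} [∀ p d, IsProbabilityMeasure (P p d)]
    {L : ∀ p d, Fin p → Ω p d → EuclideanSpace ℝ (Fin d)}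
    {Z : ∀ p d, Ω p d → EuclideanSpace ℝ (Fin d)}
    (hL_unif : ∀ p d, 2 ≤ d → ∀ j, HasLaw (L p d j) (unifSphere d) (P p d))
    (hL_indep : ∀ p d, 2 ≤ d → iIndepFun (L p d) (P p d))
    (hLZ_indep : ∀ p d, 2 ≤ d → IndepFun (fun ω j => L p d j ω) (Z p d) (P p d))
    {ν : ∀ d : ℕ, Measure (EuclideanSpace ℝ (Fin d))} {u : ℕ → ℝ}
    (hν : ∀ d, 2 ≤ d → IsProbabilityMeasure (ν d))
    (hZ : ∀ p d, 2 ≤ d → HasLaw (Z p d) (ν d) (P p d))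
    (hu : TendstoInProb ν (fun d z => ‖z‖ ^ 2 / u d) atTop 1) :
    TendstoInProb (fun i : ℕ × ℕ => P i.1 i.2)
      (fun i ω => maxAbsInner (fun j => L i.1 i.2 j ω) (Z i.1 i.2 ω) / rexBound (u i.2) i.1 i.2)
      (atTop ×ˢ atTop) 1 := by
  intro δ hδ
  -- The lower cap bound needs `η < 1`; shrinking `δ` only enlarges the event.
  set η : ℝ := min δ (1 / 2)
  have hη : 0 < η := lt_min hδ (by norm_num)
  have hη1 : η < 1 := (min_le_right _ _).trans_lt (by norm_num)
  set c : ℝ := Real.exp (-(1 + 1 / (η / 2)) / 2) / √(2 * Real.pi)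
  have hc : 0 < c := by positivity
  have hZ0 : Tendsto (fun i : ℕ × ℕ => ν i.2 {z | η < |‖z‖ ^ 2 / u i.2 - 1|})
      (atTop ×ˢ atTop) (𝓝 0) := (hu η hη).comp tendsto_snd
  have hA : Tendsto (fun i : ℕ × ℕ => ENNReal.ofReal (2 * (i.1 : ℝ) ^ (-η)))
      (atTop ×ˢ atTop) (𝓝 0) := by
    have h := (((tendsto_rpow_neg_atTop hη).comp tendsto_natCast_atTop_atTop).const_mul 2).comp
      (tendsto_fst (f := (atTop : Filter ℕ)) (g := (atTop : Filter ℕ)))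
    simpa using ENNReal.tendsto_ofReal h
  have hB : Tendsto (fun i : ℕ × ℕ => ENNReal.ofReal (Real.exp (-(c * (i.1 : ℝ) ^ (η / 2)))))
      (atTop ×ˢ atTop) (𝓝 0) := by
    have h := (Real.tendsto_exp_neg_atTop_nhds_zero.comp
      (((tendsto_rpow_atTop (half_pos hη)).comp tendsto_natCast_atTop_atTop).const_mul_atTop
        hc)).comp (tendsto_fst (f := (atTop : Filter ℕ)) (g := (atTop : Filter ℕ)))
    simpa using ENNReal.tendsto_ofReal h
  have hsum := (hZ0.add hA).add hB
  rw [add_zero, add_zero] at hsum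
  refine tendsto_of_tendsto_of_tendsto_of_le_of_le' tendsto_const_nhds hsum
    (.of_forall fun _ => zero_le) ?_
  filter_upwards [(eventually_ge_atTop 2).prod_mk
    ((eventually_ge_atTop 2).and (hu.eventually_pos hν))] with i ⟨hp, hd, hui⟩
  have hZl := hZ i.1 i.2 hd
  refine (measure_mono fun ω hω => ?_).trans ((measure_maxAbsInner_div_rexBound_le hp hd
    (hL_unif _ _ hd) (hL_indep _ _ hd) hZl.aemeasurable (hLZ_indep _ _ hd) hui hη hη1).trans_eq ?_)
  · have hω' : δ < |maxAbsInner (fun j => L i.1 i.2 j ω) (Z i.1 i.2 ω) /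
        rexBound (u i.2) i.1 i.2 - 1| := hω
    exact lt_of_le_of_lt (min_le_left _ _) hω'
  · rw [hZl.measure_eq (p := fun z => η < |‖z‖ ^ 2 / u i.2 - 1|)
      (measurableSet_lt (by fun_prop) (by fun_prop))]

/-! ### Gaussian norm and conclusion. -/

/-- Weak law of large numbers for the squared norm of a standard Gaussian vector. -/
lemma tendstoInProb_stdGaussian_norm_sq_div :
    TendstoInProb (fun d : ℕ => stdGaussian (EuclideanSpace ℝ (Fin d)))
      (fun d z => ‖z‖ ^ 2 / (d : ℝ)) atTop 1 := by
  intro δ hδ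
  set γ : Measure ℝ := gaussianReal 0 1
  set V : ℝ := Var[fun x : ℝ => x ^ 2; γ]
  have hmem : MemLp (fun x : ℝ => x ^ 2) 2 γ := by
    have h4 : MemLp (fun x : ℝ => x) 4 γ := memLp_id_gaussianReal' 4 (by simp)
    -- Hölder with `1/4 + 1/4 = 1/2`.
    simpa [pow_two, Pi.mul_def] using h4.mul h4 (r := 2) (hpqr := ⟨by
      rw [← two_mul, show (4 : ENNReal) = 2 * 2 by norm_num,
        ENNReal.mul_inv (by simp) (by simp), ← mul_assoc,
        ENNReal.mul_inv_cancel (by simp) (by simp), one_mul]⟩)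
  have hone : ∫ x, x ^ 2 ∂γ = 1 := by
    have h := variance_id_gaussianReal (μ := 0) (v := 1)
    rw [variance_of_integral_eq_zero aemeasurable_id (by simp)] at h
    simpa using h
  have hlim : Tendsto (fun d : ℕ => ENNReal.ofReal (V / δ ^ 2 / d)) atTop (𝓝 0) := by
    simpa using ENNReal.tendsto_ofReal (tendsto_const_div_atTop_nhds_zero_nat (V / δ ^ 2))
  refine tendsto_of_tendsto_of_tendsto_of_le_of_le' tendsto_const_nhds hlim
    (.of_forall fun _ => zero_le) ?_
  filter_upwards [eventually_ge_atTop 1] with d hd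
  have hd0 : (0 : ℝ) < d := by exact_mod_cast hd
  set μ : Measure (Fin d → ℝ) := Measure.pi fun _ => γ
  set S : (Fin d → ℝ) → ℝ := ∑ i, fun x => x i ^ 2 with hS
  have hcoord : ∀ i : Fin d, MemLp (fun x : Fin d → ℝ => x i ^ 2) 2 μ := fun i =>
    hmem.comp_measurePreserving (measurePreserving_eval (fun _ : Fin d => γ) i)
  have hSmem : MemLp S 2 μ := memLp_finsetSum' _ fun i _ => hcoord i
  have hmean : ∫ x, S x ∂μ = (d : ℝ) := by
    simp only [hS, Finset.sum_apply]
    rw [integral_finsetSum _ fun i _ => (hcoord i).integrable one_le_two]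
    have : ∀ i : Fin d, ∫ x, x i ^ 2 ∂μ = 1 := fun i => by
      rw [← hone]
      exact integral_comp_eval (μ := fun _ : Fin d => γ) (f := fun x : ℝ => x ^ 2)
        (i := i) (by fun_prop)
    simp [this]
  have hvar : Var[S; μ] = d * V := by
    rw [hS, variance_sum_pi (X := fun _ x => x ^ 2) fun _ => hmem]
    simp [V]
  -- Chebyshev at distance `δ d` gives `d V / (δ d)² = V / δ² / d`; the value of `V` is irrelevant.
  have hcheb := meas_ge_le_variance_div_sq hSmem (mul_pos hδ hd0)
  rw [hmean, hvar] at hcheb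
  rw [← map_pi_eq_stdGaussian, Measure.map_apply (by fun_prop)
    (measurableSet_lt (by fun_prop) (by fun_prop))]
  refine (measure_mono fun x hx => ?_).trans (hcheb.trans_eq ?_)
  · have hx' : δ < |‖WithLp.toLp 2 x‖ ^ 2 / (d : ℝ) - 1| := hx
    have hSx : S x = ‖WithLp.toLp 2 x‖ ^ 2 := by
      simp [hS, EuclideanSpace.real_norm_sq_eq]
    change δ * d ≤ |S x - d|
    rw [hSx, ← le_div_iff₀ hd0, ← abs_of_pos hd0, ← abs_div, abs_of_pos hd0, sub_div,
      div_self hd0.ne']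
    exact hx'.le
  · congr 1
    field_simp

theorem theorem5
    {Ω : ℕ → ℕ → Type*} [∀ p d, MeasurableSpace (Ω p d)]
    (P : ∀ p d, Measure (Ω p d)) [∀ p d, IsProbabilityMeasure (P p d)]
    (L : ∀ p d, Fin p → Ω p d → EuclideanSpace ℝ (Fin d))
    (Z : ∀ p d, Ω p d → EuclideanSpace ℝ (Fin d))
    -- `L_1, …, L_p` are i.i.d. uniform on `S^{d-1}` and (jointly) independent of `Z`
    (hL_unif : ∀ p d, 2 ≤ d → ∀ j, HasLaw (L p d j) (unifSphere d) (P p d))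
    (hL_indep : ∀ p d, 2 ≤ d → iIndepFun (L p d) (P p d))
    (hLZ_indep : ∀ p d, 2 ≤ d → IndepFun (fun ω j => L p d j ω) (Z p d) (P p d)) :
    -- elliptical case
    (∀ (ν : ∀ d : ℕ, Measure (EuclideanSpace ℝ (Fin d))) (u : ℕ → ℝ),
      (∀ d, 2 ≤ d → IsElliptical (ν d) 0 1) →
      (∀ p d, 2 ≤ d → HasLaw (Z p d) (ν d) (P p d)) →
      TendstoInProb ν (fun d z => ‖z‖ ^ 2 / u d) atTop 1 →
      TendstoInProb (fun i : ℕ × ℕ => P i.1 i.2)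
        (fun i ω => maxAbsInner (fun j => L i.1 i.2 j ω) (Z i.1 i.2 ω) / rexBound (u i.2) i.1 i.2)
        (atTop ×ˢ atTop) 1) ∧
    -- Gaussian case
    ((∀ p d, 2 ≤ d → HasLaw (Z p d) (stdGaussian (EuclideanSpace ℝ (Fin d))) (P p d)) →
      TendstoInProb (fun i : ℕ × ℕ => P i.1 i.2)
        (fun i ω => maxAbsInner (fun j => L i.1 i.2 j ω) (Z i.1 i.2 ω) / rexBound i.2 i.1 i.2)
        (atTop ×ˢ atTop) 1) :=
  ⟨fun _ _ hν hZ hu => tendstoInProb_maxAbsInner_div_rexBound hL_unif hL_indep hLZ_indep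
      (fun d hd => (hν d hd).1) hZ hu,
    fun hZ => tendstoInProb_maxAbsInner_div_rexBound hL_unif hL_indep hLZ_indep
      (fun _ _ => inferInstance) hZ tendstoInProb_stdGaussian_norm_sq_div⟩
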